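/- All digraphs are finite and simple: they have no loops and no parallel arcs, but a pair of opposite arcs between two vertices is allowed. For an integer $l\ge 2$, the $l$-connectivity of a strongly connected digraph is the minimum number of vertices whose removal produces a digraph with at least $l$ strongly connected components or a digraph with fewer than $l$ vertices. The spectral radius $\rho(D)$ of a digraph $D$ is the largest modulus of an eigenvalue of its adjacency matrix. Let $l\ge 2$, $k\ge 1$ and $n\ge k+l$ be integers. Choose $j\in\{1,\dots,l\}$, and put $n_j=n-k-l+1$ and $n_i=1$ for $i\ne j$. Let $\overrightarrow{G}_n^{k}$ be the digraph of order $n$ obtained from disjoint complete digraphs $\overrightarrow{K}_k$, $\overrightarrow{K}_{n_1},\dots,\overrightarrow{K}_{n_l}$ by adding all arcs in both directions between $\overrightarrow{K}_k$ and each $\overrightarrow{K}_{n_i}$, and all arcs from $\overrightarrow{K}_{n_i}$ to $\overrightarrow{K}_{n_{i'}}$ for $1\le i<i'\le l$. Then, for every choice of $j$, $\overrightarrow{G}_n^{k}$ has the maximum spectral radius among all strongly connected digraphs of order $n$ with $l$-connectivity $k$; that is, it is itself such a digraph, and $\rho(D)\le\rho(\overrightarrow{G}_n^{k})$ for every such digraph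 $D$. -/

import Mathlib

open scoped ENNReal

namespace Digraph

/-- A digraph is simple if it has no loops. (Parallel arcs cannot occur in a `Digraph`; a pair of
opposite arcs between two vertices is allowed.) -/
def IsSimple {V : Type*} (D : Digraph V) : Prop :=
  ∀ v, ¬ D.Adj v v

/-- There is a directed path (possibly of length zero) from `x` to `y`. -/
def Reaches {V : Type*} (D : Digraph V) (x y : V) : Prop :=
  Relation.ReflTransGen D.Adj x y

/-- Any two vertices are joined by directed paths in both directions. -/
def IsStronglyConnected {V : Type*} (D : Digraph V) : Prop :=
  ∀ x y, D.Reaches x y ∧ D.Reaches y x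

/-- Mutual reachability; its classes are the vertex sets of the strongly connected components. -/
def strongSetoid {V : Type*} (D : Digraph V) : Setoid V where
  r x y := D.Reaches x y ∧ D.Reaches y x
  iseqv :=
    { refl := fun _ => ⟨Relation.ReflTransGen.refl, Relation.ReflTransGen.refl⟩
      symm := fun h => ⟨h.2, h.1⟩
      trans := fun h k => ⟨Relation.ReflTransGen.trans h.1 k.1,
        Relation.ReflTransGen.trans k.2 h.2⟩ }

/-- The number of strongly connected components. -/
noncomputable def numStrongComponents {V : Type*} (D : Digraph V) : ℕ :=
  Nat.card (Quotient D.strongSetoid)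

/-- The digraph `D - S` obtained by removing the vertices in `S`. -/
def deleteVerts {V : Type*} (D : Digraph V) (S : Finset V) : Digraph {v : V // v ∉ S} where
  Adj a b := D.Adj a.1 b.1

/-- The `l`-connectivity: the minimum number of vertices whose removal produces a digraph with at
least `l` strongly connected components or a digraph with fewer than `l` vertices. (For `l ≥ 1` and
`V` finite, the set is nonempty because all the vertices may be removed.) -/
noncomputable def lConnectivity {V : Type*} [Fintype V] (D : Digraph V) (l : ℕ) : ℕ :=
  sInf {k : ℕ | ∃ S : Finset V, S.card = k ∧
    (l ≤ (D.deleteVerts S).numStrongComponents ∨ Nat.card {v : V // v ∉ S} < l)}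

open Classical in
/-- The adjacency matrix, with complex entries. -/
noncomputable def adjMatrix {V : Type*} (D : Digraph V) : Matrix V V ℂ :=
  Matrix.of fun u v => if D.Adj u v then 1 else 0

/-- The spectral radius of a digraph: the largest modulus of an eigenvalue of its adjacency
matrix. -/
noncomputable def specRadius {V : Type*} [Fintype V] [DecidableEq V] (D : Digraph V) : ℝ≥0∞ :=
  _root_.spectralRadius ℂ D.adjMatrix

/-- The complete digraph without loops on the vertex type `V`. -/
def completeSimple (V : Type*) : Digraph V where
  Adj u v := u ≠ v

/-- The join `D₁ ∇ D₂`: the disjoint union together with all arcs in both directions between the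
two parts. -/
def join {V W : Type*} (D₁ : Digraph V) (D₂ : Digraph W) : Digraph (V ⊕ W) where
  Adj
    | .inl a, .inl b => D₁.Adj a b
    | .inr a, .inr b => D₂.Adj a b
    | .inl _, .inr _ => True
    | .inr _, .inl _ => True

/-- The disjoint union of complete digraphs of orders `m 0, …, m (l - 1)`, together with all arcs
from an earlier block to a later block: distinct vertices in the same block are joined in both
directions, and those in different blocks by the one arc from the earlier to the later block. -/
def orderedBlocks {l : ℕ} (m : Fin l → ℕ) : Digraph (Σ i : Fin l, Fin (m i)) where
  Adj a b := a ≠ b ∧ a.1 ≤ b.1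

/-- The join of the complete digraph of order `k` with the ordered blocks of orders `m i`. -/
def blockJoin (k : ℕ) {l : ℕ} (m : Fin l → ℕ) : Digraph (Fin k ⊕ (Σ i : Fin l, Fin (m i))) :=
  (completeSimple (Fin k)).join (orderedBlocks m)

/-- Block orders of the extremal digraph: block `j` has order `n - k - l + 1`, and every other block
has order `1`. -/
def extremalOrders (n k l : ℕ) (j : Fin l) : Fin l → ℕ :=
  fun i => if i = j then n - k - l + 1 else 1

/-- The extremal digraph of order `n`, with its large block in position `j`. -/
def extremal (n k l : ℕ) (j : Fin l) :
    Digraph (Fin k ⊕ (Σ i : Fin l, Fin (extremalOrders n k l j i))) :=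
  blockJoin k (extremalOrders n k l j)

/-- `D` is a simple strongly connected digraph of order `n` with `l`-connectivity `k`. -/
structure IsInClass {V : Type*} [Fintype V] (D : Digraph V) (n k l : ℕ) : Prop where
  simple : D.IsSimple
  order : Fintype.card V = n
  stronglyConnected : D.IsStronglyConnected
  connectivity : D.lConnectivity l = k

end Digraph

/-! Deleting a minimum separator `S` (`#S = k`) from `D` leaves at least `l` strong components,
since `n - k ≥ l` vertices remain. Ordering these topologically and merging the surplus gives `l`
nonempty blocks with no arc running backwards, so `D` lies inside a join of a complete digraph on
`S` with ordered blocks of orders `m i`.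

For such a join, put `t = ρ + 1`; an eigenvector satisfies `t * x v` = the sum of `x` over the
closed out-neighbourhood of `v`. With `x = 1` on `S`, solving from the last block backwards gives `x
= (k / t) * ∏ a ≥ i, (1 - m a / t)⁻¹` on block `i`. The rows in `S` then give the characteristic
equation `∏ (1 - m i / t) = k / t`, in which the order of the blocks plays no role.

Fix a root `t` for the extremal orders, larger than all of them. Among positive orders with the same
sum, the extremal ones minimise the product (Weierstrass inequality), so for the blocks of `D` the
equation becomes `k / t ≤ ∏ (1 - m i / t)`. The vector `x` built from the orders of `D` then
satisfies `A x ≤ (t - 1) x`, and Collatz–Wielandt gives `ρ(D) ≤ t - 1`, while `t - 1` is an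
eigenvalue of the extremal digraph. -/

open Finset in
/-- Weierstrass product inequality. -/
theorem one_sub_sum_le_prod_one_sub_of_le_one {ι : Type*} (s : Finset ι) (f : ι → ℝ)
    (h0 : ∀ i ∈ s, 0 ≤ f i) (h1 : ∀ i ∈ s, f i ≤ 1) :
    1 - ∑ i ∈ s, f i ≤ ∏ i ∈ s, (1 - f i) := by
  classical
  induction s using Finset.induction_on with
  | empty => simp
  | insert a s ha ih =>
    rw [sum_insert ha, prod_insert ha]
    have ih' := ih (fun i hi => h0 i (mem_insert_of_mem hi)) (fun i hi => h1 i (mem_insert_of_mem hi))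
    have hsum : 0 ≤ ∑ i ∈ s, f i := sum_nonneg fun i hi => h0 i (mem_insert_of_mem hi)
    have ha0 := h0 a (mem_insert_self a s)
    have ha1 := h1 a (mem_insert_self a s)
    nlinarith [mul_le_mul_of_nonneg_left ih' (sub_nonneg.2 ha1), mul_nonneg ha0 hsum]

/-! ### Eigenvectors and a bound on eigenvalues -/

namespace Matrix

variable {V : Type*} [Fintype V] [DecidableEq V]

theorem exists_eigenvector_of_mem_spectrum {A : Matrix V V ℂ} {μ : ℂ} (hμ : μ ∈ spectrum ℂ A) :
    ∃ z : V → ℂ, z ≠ 0 ∧ A *ᵥ z = μ • z := by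
  rw [← Matrix.spectrum_toLin', ← Module.End.hasEigenvalue_iff_mem_spectrum] at hμ
  obtain ⟨z, hz⟩ := hμ.exists_hasEigenvector
  exact ⟨z, hz.2, by simpa using hz.apply_eq_smul⟩

theorem mem_spectrum_of_eigenvector {A : Matrix V V ℂ} {μ : ℂ} {z : V → ℂ} (hz : z ≠ 0)
    (h : A *ᵥ z = μ • z) : μ ∈ spectrum ℂ A := by
  rw [← Matrix.spectrum_toLin', ← Module.End.hasEigenvalue_iff_mem_spectrum]
  exact Module.End.hasEigenvalue_of_hasEigenvector
    (Module.End.hasEigenvector_iff.2 ⟨Module.End.mem_eigenspace_iff.2 (by simpa using h), hz⟩)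

/-- The Collatz–Wielandt upper bound for the modulus of an eigenvalue. -/
theorem norm_le_of_mem_spectrum_of_sum_le {A : Matrix V V ℂ} {x : V → ℝ} {r : ℝ}
    (hx : ∀ v, 0 < x v) (hA : ∀ v, ∑ w, ‖A v w‖ * x w ≤ r * x v) {μ : ℂ}
    (hμ : μ ∈ spectrum ℂ A) : ‖μ‖ ≤ r := by
  obtain ⟨z, hz, hAz⟩ := exists_eigenvector_of_mem_spectrum hμ
  obtain ⟨u, hu⟩ := Function.ne_iff.1 hz
  obtain ⟨v, -, hv⟩ := Finset.exists_max_image Finset.univ (fun v => ‖z v‖ / x v) ⟨u, Finset.mem_univ u⟩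
  set M := ‖z v‖ / x v with hM
  have hMpos : 0 < M := lt_of_lt_of_le (div_pos (norm_pos_iff.2 hu) (hx u)) (hv u (Finset.mem_univ u))
  have hle : ∀ w, ‖z w‖ ≤ M * x w := fun w => (div_le_iff₀ (hx w)).1 (hv w (Finset.mem_univ w))
  have hzv : ‖z v‖ = M * x v := by rw [hM, div_mul_cancel₀ _ (hx v).ne']
  have key : ‖μ‖ * ‖z v‖ ≤ M * (r * x v) := by
    calc ‖μ‖ * ‖z v‖ = ‖(A *ᵥ z) v‖ := by rw [hAz]; simp
      _ ≤ ∑ w, ‖A v w‖ * ‖z w‖ := by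
        simp only [mulVec, dotProduct]
        exact (norm_sum_le _ _).trans (by simp)
      _ ≤ ∑ w, ‖A v w‖ * (M * x w) :=
        Finset.sum_le_sum fun w _ => mul_le_mul_of_nonneg_left (hle w) (norm_nonneg _)
      _ = M * ∑ w, ‖A v w‖ * x w := by
        rw [Finset.mul_sum]; exact Finset.sum_congr rfl fun w _ => by ring
      _ ≤ _ := mul_le_mul_of_nonneg_left (hA v) hMpos.le
  rw [hzv] at key
  have hp : 0 < M * x v := mul_pos hMpos (hx v)
  refine le_of_mul_le_mul_right ?_ hp
  linarith

end Matrix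

namespace Digraph

open Finset

/-! ### The weights of the ordered blocks -/

/-- The entry at block `i`, up to a constant, of the Perron vector of the ordered blocks of orders
`m`, as a function of `t = ρ + 1`. -/
noncomputable def blockWeight {l : ℕ} (m : Fin l → ℕ) (t : ℝ) (i : Fin l) : ℝ :=
  ∏ a ∈ Ici i, (1 + m a / (t - m a))

theorem blockWeight_pos {l : ℕ} {m : Fin l → ℕ} {t : ℝ} (ht : ∀ i, (m i : ℝ) < t) (i : Fin l) :
    0 < blockWeight m t i :=
  prod_pos fun a _ => add_pos_of_pos_of_nonneg one_pos
    (div_nonneg (Nat.cast_nonneg _) (sub_nonneg.2 (ht a).le))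

/-- Telescoping: with `y i = m i / (t - m i)`, the `i`-th summand is `y i * ∏ a > i, (1 + y a)`. The
order dual makes the inner product run over later indices, and an upper set contains all of these.
-/
theorem one_add_sum_blockWeight {l : ℕ} {m : Fin l → ℕ} {t : ℝ} (ht : ∀ i, (m i : ℝ) < t)
    (U : Finset (Fin l)) (hU : IsUpperSet (U : Set (Fin l))) :
    1 + ∑ i ∈ U, m i * (blockWeight m t i / t) = ∏ i ∈ U, (1 + m i / (t - m i) : ℝ) := by
  have h := prod_one_add_ordered (ι := (Fin l)ᵒᵈ) U (fun i => (m i / (t - m i) : ℝ))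
  refine Eq.trans ?_ h.symm
  congr 1
  refine sum_congr rfl fun i hi => ?_
  have h1 : Ici i = insert i {a ∈ U | i < a} := by
    ext a
    simp only [mem_Ici, mem_insert, mem_filter]
    constructor
    · intro hia
      rcases hia.eq_or_lt with rfl | hlt
      · exact Or.inl rfl
      · exact Or.inr ⟨hU hia hi, hlt⟩
    · rintro (rfl | ⟨-, h⟩)
      exacts [le_rfl, h.le]
  have h2 : blockWeight m t i
      = (1 + m i / (t - m i)) * ∏ a ∈ U with i < a, (1 + m a / (t - m a) : ℝ) := by
    rw [blockWeight, h1, prod_insert (by simp)]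
  have ht0 : t ≠ 0 := ((Nat.cast_nonneg (m i)).trans_lt (ht i)).ne'
  have hs : t - m i ≠ 0 := (sub_pos.2 (ht i)).ne'
  rw [h2]
  change _ = (m i / (t - m i) : ℝ) * ∏ a ∈ U with i < a, (1 + m a / (t - m a) : ℝ)
  field_simp
  ring

theorem prod_one_add_mul_prod_one_sub {l : ℕ} {m : Fin l → ℕ} {t : ℝ} (ht : ∀ i, (m i : ℝ) < t) :
    (∏ i, (1 + m i / (t - m i) : ℝ)) * ∏ i, (1 - m i / t : ℝ) = 1 := by
  rw [← prod_mul_distrib]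
  refine prod_eq_one fun i _ => ?_
  have ht0 : t ≠ 0 := ((Nat.cast_nonneg (m i)).trans_lt (ht i)).ne'
  have hs : t - m i ≠ 0 := (sub_pos.2 (ht i)).ne'
  field_simp
  ring

/-- The characteristic equation of the ordered blocks has a root above any given order. -/
theorem exists_prod_one_sub_eq {l : ℕ} {m : Fin l → ℕ} {k : ℕ} (hk : 1 ≤ k) (j : Fin l)
    (hmj : 1 ≤ m j) :
    ∃ t : ℝ, (m j : ℝ) < t ∧ ∏ i, (1 - m i / t : ℝ) = k / t := by
  have hmj' : (1 : ℝ) ≤ m j := by exact_mod_cast hmj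
  have hk' : (1 : ℝ) ≤ k := by exact_mod_cast hk
  let φ : ℝ → ℝ := fun t => ∏ i, (1 - m i / t : ℝ) - k / t
  -- At the total order `T` the Weierstrass inequality gives `φ T ≥ 0`; at `m j` the product
  -- vanishes, so `φ (m j) < 0`.
  set T : ℝ := k + ∑ i, (m i : ℝ) with hT
  have hle : ∀ i, (m i : ℝ) ≤ T := fun i => by
    have := single_le_sum (f := fun i => (m i : ℝ)) (fun i _ => Nat.cast_nonneg _) (mem_univ i)
    linarith
  have hTpos : 0 < T := by linarith [hle j]
  have hcont : ContinuousOn φ (Set.Icc (m j : ℝ) T) := by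
    have hne : ∀ t ∈ Set.Icc (m j : ℝ) T, t ≠ 0 := fun t ht => by linarith [ht.1] |> ne_of_gt
    refine ContinuousOn.sub (continuousOn_finsetProd _ fun i _ => ?_) ?_
    · exact continuousOn_const.sub (continuousOn_const.div continuousOn_id hne)
    · exact continuousOn_const.div continuousOn_id hne
  have h0 : φ (m j) < 0 := by
    have : ∏ i, (1 - m i / m j : ℝ) = 0 :=
      prod_eq_zero (mem_univ j) (by rw [div_self (by linarith), sub_self])
    simp only [φ, this, zero_sub]
    exact neg_neg_of_pos (by positivity)
  have h1 : 0 ≤ φ T := by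
    have := one_sub_sum_le_prod_one_sub_of_le_one univ (fun i => (m i / T : ℝ))
      (fun i _ => by positivity) (fun i _ => div_le_one_of_le₀ (hle i) hTpos.le)
    have h2 : 1 - ∑ i, (m i / T : ℝ) = k / T := by
      rw [← sum_div]; field_simp; linarith
    simp only [φ]
    linarith
  obtain ⟨t, ht, hφ⟩ := intermediate_value_Icc (hle j) hcont ⟨h0.le, h1⟩
  refine ⟨t, lt_of_le_of_ne ht.1 ?_, sub_eq_zero.1 hφ⟩
  rintro rfl
  exact h0.ne hφ

/-- Among block orders with a given sum, the product is smallest when all but one are `1`. -/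
theorem prod_one_sub_extremal_le {l : ℕ} {m : Fin l → ℕ} (hm : ∀ i, 1 ≤ m i) (j : Fin l) {M : ℕ}
    (hM : ∑ i, m i = M + (l - 1)) {t : ℝ} (ht : (M : ℝ) < t) (ht1 : 1 < t) :
    (∏ i, (1 - ((if i = j then M else 1 : ℕ) : ℝ) / t)) ≤ ∏ i, (1 - m i / t : ℝ) := by
  have hl : 1 ≤ l := j.pos
  have hu : 0 < 1 - 1 / t := by
    rw [sub_pos, div_lt_one (by linarith)]; exact ht1
  set u := 1 - 1 / t with hu'
  have htpos : 0 < t := by linarith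
  have htup : 0 < t - 1 := by linarith
  have hsumR : ∑ i, ((m i : ℝ) - 1) = M - 1 := by
    have : (∑ i, (m i : ℝ)) = M + ((l - 1 : ℕ) : ℝ) := by exact_mod_cast hM
    rw [sum_sub_distrib, this, Nat.cast_sub hl]; simp; ring
  have h1 : ∀ i, (0 : ℝ) ≤ m i - 1 := fun i => by
    have : (1 : ℝ) ≤ m i := by exact_mod_cast hm i
    linarith
  -- Factoring out `1 - 1 / t` makes blocks of order `1` contribute the factor `1`, so Weierstrass
  -- is an equality for the extremal orders.
  have hfac : ∀ c : ℝ, 1 - c / t = u * (1 - (c - 1) / (t - 1)) := fun c => by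
    rw [hu']; field_simp; ring
  have hw := one_sub_sum_le_prod_one_sub_of_le_one univ (fun i => ((m i - 1) / (t - 1) : ℝ))
    (fun i _ => div_nonneg (h1 i) htup.le) (fun i _ => by
      refine div_le_one_of_le₀ ?_ htup.le
      have := single_le_sum (f := fun i => (m i : ℝ) - 1) (fun i _ => h1 i) (mem_univ i)
      simp only [hsumR] at this
      linarith)
  rw [← sum_div, hsumR] at hw
  simp only [hfac, prod_mul_distrib]
  refine mul_le_mul_of_nonneg_left ?_ (prod_nonneg fun _ _ => hu.le)
  refine le_trans (le_of_eq ?_) hw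
  rw [prod_eq_single j (fun i _ hij => by simp [hij]) (by simp)]
  simp

/-! ### Digraphs with ordered blocks -/

section Blocks

variable {V : Type*} [Fintype V] [DecidableEq V] {l : ℕ}

/-- The number of vertices outside `S` which are labelled `i`. -/
def blockOrder (S : Finset V) (b : V → Fin l) (i : Fin l) : ℕ :=
  #{v | v ∉ S ∧ b v = i}

/-- Distinct vertices, not running from a later to an earlier block outside of `S`. -/
def BlockAdj (S : Finset V) (b : V → Fin l) (v w : V) : Prop :=
  v ≠ w ∧ (v ∈ S ∨ w ∈ S ∨ b v ≤ b w)

/-- A positive vector which is constant on `S` and on each block. -/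
noncomputable def blockVector (S : Finset V) (b : V → Fin l) (t : ℝ) (v : V) : ℝ :=
  if v ∈ S then 1 else #S * (blockWeight (blockOrder S b) t (b v) / t)

theorem blockVector_pos {S : Finset V} {b : V → Fin l} {t : ℝ} (hS : 1 ≤ #S)
    (ht : ∀ i, (blockOrder S b i : ℝ) < t) (v : V) : 0 < blockVector S b t v := by
  unfold blockVector
  split_ifs
  · exact one_pos
  · have ht0 : 0 < t := (Nat.cast_nonneg _).trans_lt (ht (b v))
    have := blockWeight_pos ht (b v)
    have : (0 : ℝ) < #S := by exact_mod_cast hS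
    positivity

theorem sum_notMem_comp (S : Finset V) (b : V → Fin l) (g : Fin l → ℝ) :
    ∑ w with w ∉ S, g (b w) = ∑ i, blockOrder S b i * g i := by
  rw [← sum_fiberwise_of_maps_to (t := univ) (g := b) (fun _ _ => mem_univ _)]
  refine sum_congr rfl fun i _ => ?_
  rw [sum_congr rfl (g := fun _ => g i) (fun w hw => by rw [(mem_filter.1 hw).2]), sum_const,
    nsmul_eq_mul, filter_filter]
  rfl

theorem sum_blockVector {S : Finset V} {b : V → Fin l} {t : ℝ}
    (ht : ∀ i, (blockOrder S b i : ℝ) < t) (U : Finset (Fin l))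
    (hU : IsUpperSet (U : Set (Fin l))) :
    ∑ w with w ∈ S ∨ b w ∈ U, blockVector S b t w =
      #S * ∏ i ∈ U, (1 + blockOrder S b i / (t - blockOrder S b i) : ℝ) := by
  rw [← one_add_sum_blockWeight ht U hU, mul_add, mul_one, sum_filter,
    ← sum_filter_add_sum_filter_not univ (· ∈ S)]
  congr 1
  · rw [sum_congr rfl (g := fun _ => (1 : ℝ)) (fun w hw => by
      have : w ∈ S := (mem_filter.1 hw).2
      simp [blockVector, this])]
    simp
  · rw [sum_congr rfl (g := fun w => (fun i => if i ∈ U then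
        #S * (blockWeight (blockOrder S b) t i / t) else 0) (b w)) (fun w hw => by
      have : w ∉ S := (mem_filter.1 hw).2
      simp [blockVector, this]), sum_notMem_comp S b (fun i => if i ∈ U then
        #S * (blockWeight (blockOrder S b) t i / t) else 0), mul_sum]
    simp only [mul_ite, mul_zero]
    rw [← sum_filter]
    simp only [filter_mem_eq_inter, univ_inter]
    exact sum_congr rfl fun i _ => by ring

open Classical in
-- The closed out-neighbourhood of `v` is `S` together with the blocks from `b v` on, of total
-- weight `t * x v`. These rows balance for every admissible `t`; only the rows in `S` constrain it.
theorem sum_blockAdj_of_notMem {S : Finset V} {b : V → Fin l} {t : ℝ}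
    (ht : ∀ i, (blockOrder S b i : ℝ) < t) {v : V} (hv : v ∉ S) :
    ∑ w with BlockAdj S b v w, blockVector S b t w = (t - 1) * blockVector S b t v := by
  have h := sum_blockVector ht (Ici (b v)) (by rw [coe_Ici]; exact isUpperSet_Ici _)
  have hfil : univ.filter (fun w => w ∈ S ∨ b w ∈ Ici (b v)) =
      insert v (univ.filter (BlockAdj S b v)) := by
    ext w
    simp only [BlockAdj, mem_filter, mem_univ, true_and, mem_Ici, mem_insert]
    by_cases hvw : w = v
    · simp [hvw]
    · simp [hvw, hv, Ne.symm hvw]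
  rw [hfil, sum_insert (by simp [BlockAdj])] at h
  have ht0 : t ≠ 0 := ((Nat.cast_nonneg _).trans_lt (ht (b v))).ne'
  have hx : t * blockVector S b t v
      = #S * ∏ i ∈ Ici (b v), (1 + blockOrder S b i / (t - blockOrder S b i) : ℝ) := by
    rw [blockVector, if_neg hv, blockWeight]
    field_simp
  linarith

open Classical in
theorem sum_blockAdj_of_mem {S : Finset V} {b : V → Fin l} {t : ℝ}
    (ht : ∀ i, (blockOrder S b i : ℝ) < t) {v : V} (hv : v ∈ S) :
    ∑ w with BlockAdj S b v w, blockVector S b t w =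
      #S * ∏ i, (1 + blockOrder S b i / (t - blockOrder S b i) : ℝ) - 1 := by
  have h := sum_blockVector ht univ (by rw [coe_univ]; exact isUpperSet_univ)
  have hfil : univ.filter (fun w => w ∈ S ∨ b w ∈ univ) =
      insert v (univ.filter (BlockAdj S b v)) := by
    ext w
    simp only [BlockAdj, mem_filter, mem_univ, or_true, true_and, hv, true_or, and_true, mem_insert]
    exact ⟨fun _ => eq_or_ne w v |>.imp id Ne.symm, fun _ => trivial⟩
  rw [hfil, sum_insert (by simp [BlockAdj]), blockVector, if_pos hv] at h
  linarith

theorem specRadius_le_of_blockAdj {D : Digraph V} {S : Finset V} {b : V → Fin l} {t : ℝ}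
    (hD : ∀ v w, D.Adj v w → BlockAdj S b v w) (hS : 1 ≤ #S)
    (ht : ∀ i, (blockOrder S b i : ℝ) < t)
    (hprod : #S / t ≤ ∏ i, (1 - blockOrder S b i / t : ℝ)) :
    D.specRadius ≤ ‖((t - 1 : ℝ) : ℂ)‖₊ := by
  classical
  refine iSup₂_le fun μ hμ => ?_
  have hx := blockVector_pos hS ht
  have hμ' : ‖μ‖ ≤ t - 1 := by
    refine Matrix.norm_le_of_mem_spectrum_of_sum_le hx (fun v => ?_) hμ
    have h1 : ∑ w, ‖D.adjMatrix v w‖ * blockVector S b t w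
        ≤ ∑ w with BlockAdj S b v w, blockVector S b t w := by
      rw [sum_filter]
      refine sum_le_sum fun w _ => ?_
      simp only [adjMatrix, Matrix.of_apply]
      by_cases h : D.Adj v w
      · simp [h, hD v w h]
      · simp only [h, if_false, norm_zero, zero_mul]
        split_ifs
        exacts [(hx w).le, le_rfl]
    refine h1.trans ?_
    by_cases hv : v ∈ S
    · rw [sum_blockAdj_of_mem ht hv, blockVector, if_pos hv, mul_one]
      have ht0 : 0 < t := (Nat.cast_nonneg _).trans_lt (ht (b v))
      have hpos : 0 < ∏ i, (1 + blockOrder S b i / (t - blockOrder S b i) : ℝ) :=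
        prod_pos fun i _ => add_pos_of_pos_of_nonneg one_pos
          (div_nonneg (Nat.cast_nonneg _) (sub_nonneg.2 (ht i).le))
      have h2 := mul_le_mul_of_nonneg_left hprod hpos.le
      rw [prod_one_add_mul_prod_one_sub ht, mul_div_assoc', div_le_one ht0] at h2
      linarith
    · exact (sum_blockAdj_of_notMem ht hv).le
  rw [ENNReal.coe_le_coe, ← NNReal.coe_le_coe, coe_nnnorm, coe_nnnorm, Complex.norm_real]
  exact hμ'.trans (le_abs_self _)

theorem le_specRadius_of_blockAdj_iff {D : Digraph V} {S : Finset V} {b : V → Fin l} {t : ℝ}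
    (hD : ∀ v w, D.Adj v w ↔ BlockAdj S b v w) (hS : 1 ≤ #S)
    (ht : ∀ i, (blockOrder S b i : ℝ) < t)
    (hprod : ∏ i, (1 - blockOrder S b i / t : ℝ) = #S / t) :
    ‖((t - 1 : ℝ) : ℂ)‖₊ ≤ D.specRadius := by
  classical
  have hx := blockVector_pos hS ht
  obtain ⟨s, hs⟩ := card_pos.1 hS
  have ht0 : 0 < t := (Nat.cast_nonneg _).trans_lt (ht (b s))
  refine le_iSup₂ (f := fun (μ : ℂ) (_ : μ ∈ spectrum ℂ D.adjMatrix) => (‖μ‖₊ : ℝ≥0∞)) _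
    (Matrix.mem_spectrum_of_eigenvector (z := fun v => (blockVector S b t v : ℂ)) ?_ ?_)
  · exact fun h => (hx s).ne' (by simpa using congrFun h s)
  · ext v
    have h1 : (D.adjMatrix.mulVec fun v => (blockVector S b t v : ℂ)) v
        = ((∑ w with BlockAdj S b v w, blockVector S b t w : ℝ) : ℂ) := by
      rw [sum_filter]
      push_cast
      refine sum_congr rfl fun w _ => ?_
      simp only [adjMatrix, Matrix.of_apply, hD]
      split_ifs <;> simp
    rw [h1, Pi.smul_apply, smul_eq_mul, ← Complex.ofReal_mul]
    congr 1
    by_cases hv : v ∈ S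
    · rw [sum_blockAdj_of_mem ht hv, blockVector, if_pos hv, mul_one]
      have h2 := prod_one_add_mul_prod_one_sub ht
      rw [hprod, mul_div_assoc', div_eq_one_iff_eq ht0.ne'] at h2
      linarith
    · exact sum_blockAdj_of_notMem ht hv

theorem sum_blockOrder (S : Finset V) (b : V → Fin l) :
    ∑ i, blockOrder S b i = Fintype.card V - #S := by
  rw [← card_compl, card_eq_sum_card_fiberwise (t := univ) (f := b) (fun _ _ => by simp)]
  refine sum_congr rfl fun i _ => ?_
  rw [blockOrder]
  congr 1
  ext v
  simp

end Blocks

/-! ### Strong components in topological order -/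

/-- A finite digraph with at least `l` strong components can be cut into `l` nonempty blocks, with
no arc from a later to an earlier block. -/
theorem exists_surjective_monotone_label {V : Type*} [Finite V] (D : Digraph V) {l : ℕ}
    (hl : 1 ≤ l) (h : l ≤ D.numStrongComponents) :
    ∃ b : V → Fin l, Function.Surjective b ∧ ∀ v w, D.Adj v w → b v ≤ b w := by
  classical
  let _ : Preorder V :=
    { le := D.Reaches
      le_refl := fun _ => Relation.ReflTransGen.refl
      le_trans := fun _ _ _ => Relation.ReflTransGen.trans }
  -- The strong components, partially ordered by reachability, extended to a linear order.
  let Q := LinearExtension (Antisymmetrization V (· ≤ ·))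
  have : Finite Q := inferInstanceAs (Finite (Quotient _))
  let _ : Fintype Q := Fintype.ofFinite Q
  have hcard : l ≤ Fintype.card Q := by
    rw [← Nat.card_eq_fintype_card]
    exact h
  let e := (Fintype.orderIsoFinOfCardEq Q rfl).symm
  let p : V → Q := fun v => toLinearExtension (toAntisymmetrization (· ≤ ·) v)
  have hp : Function.Surjective p := fun q => by
    obtain ⟨v, hv⟩ := Quotient.exists_rep (s := AntisymmRel.setoid V (· ≤ ·)) q
    exact ⟨v, hv⟩
  -- Truncating at `l - 1` merges all surplus components into the last block.
  refine ⟨fun v => ⟨min (e (p v)) (l - 1), by omega⟩, fun i => ?_, fun v w hvw => ?_⟩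
  · obtain ⟨v, hv⟩ := hp (e.symm ⟨i, i.2.trans_le hcard⟩)
    refine ⟨v, Fin.ext ?_⟩
    simp only [hv, OrderIso.apply_symm_apply]
    omega
  · have h1 : p v ≤ p w :=
      toLinearExtension.monotone (toAntisymmetrization_mono (Relation.ReflTransGen.single hvw))
    have h2 : (e (p v) : ℕ) ≤ e (p w) := e.monotone h1
    exact min_le_min_right _ h2

theorem exists_separator {V : Type*} [Fintype V] (D : Digraph V) {l : ℕ} (hl : 1 ≤ l) :
    ∃ S : Finset V, #S = D.lConnectivity l ∧
      (l ≤ (D.deleteVerts S).numStrongComponents ∨ Nat.card {v : V // v ∉ S} < l) :=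
  Nat.sInf_mem (s := {k : ℕ | ∃ S : Finset V, #S = k ∧
    (l ≤ (D.deleteVerts S).numStrongComponents ∨ Nat.card {v : V // v ∉ S} < l)})
    ⟨_, univ, rfl, Or.inr (by simp; omega)⟩

theorem natCard_notMem {V : Type*} [Fintype V] (S : Finset V) :
    Nat.card {v : V // v ∉ S} = Fintype.card V - #S := by
  classical
  rw [Nat.card_eq_fintype_card, Fintype.card_subtype_compl, Fintype.card_coe]

/-- A digraph in the class is a spanning subdigraph of a join of a complete digraph with ordered
nonempty blocks. -/
theorem IsInClass.exists_blocks {V : Type*} [Fintype V] [DecidableEq V] {D : Digraph V}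
    {n k l : ℕ} (hD : D.IsInClass n k l) (hl : 1 ≤ l) (hn : k + l ≤ n) :
    ∃ (S : Finset V) (b : V → Fin l), #S = k ∧ (∀ i, 1 ≤ blockOrder S b i) ∧
      ∀ v w, D.Adj v w → BlockAdj S b v w := by
  obtain ⟨S, hS, h⟩ := D.exists_separator hl
  rw [hD.connectivity] at hS
  rw [natCard_notMem, hD.order, hS] at h
  obtain ⟨b, hb, hmono⟩ := exists_surjective_monotone_label _ hl (h.resolve_right (by omega))
  -- The label `0` on `S` is junk: neither `BlockAdj` nor `blockOrder` depends on it.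
  refine ⟨S, fun v => if hv : v ∈ S then ⟨0, hl⟩ else b ⟨v, hv⟩, hS, fun i => ?_,
    fun v w hvw => ⟨?_, ?_⟩⟩
  · obtain ⟨v, rfl⟩ := hb i
    exact card_pos.2 ⟨v.1, by simp [v.2]⟩
  · rintro rfl
    exact hD.simple v hvw
  · by_cases hv : v ∈ S
    · exact Or.inl hv
    by_cases hw : w ∈ S
    · exact Or.inr (Or.inl hw)
    · simp only [hv, hw, dif_neg, not_false_eq_true, false_or]
      exact hmono ⟨v, hv⟩ ⟨w, hw⟩ hvw

/-! ### The join of a complete digraph with ordered blocks -/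

section BlockJoin

variable {k l : ℕ} {m : Fin l → ℕ}

/-- The vertices of the complete part of `blockJoin k m`. -/
def blockJoinCore (k : ℕ) (m : Fin l → ℕ) : Finset (Fin k ⊕ (Σ i : Fin l, Fin (m i))) :=
  univ.map Function.Embedding.inl

theorem card_blockJoinCore : #(blockJoinCore k m) = k := by
  simp [blockJoinCore]

theorem inl_mem_blockJoinCore (a : Fin k) : Sum.inl a ∈ blockJoinCore k m := by
  simp [blockJoinCore]

theorem inr_notMem_blockJoinCore (a : Σ i : Fin l, Fin (m i)) :
    Sum.inr a ∉ blockJoinCore k m := by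
  simp [blockJoinCore]

/-- The block of a vertex of `blockJoin k m`, with the junk value `j` on the complete part. -/
def blockJoinLabel (k : ℕ) (m : Fin l → ℕ) (j : Fin l) :
    Fin k ⊕ (Σ i : Fin l, Fin (m i)) → Fin l :=
  Sum.elim (fun _ => j) Sigma.fst

theorem blockJoin_adj_iff (j : Fin l) (v w : Fin k ⊕ (Σ i : Fin l, Fin (m i))) :
    (blockJoin k m).Adj v w ↔ BlockAdj (blockJoinCore k m) (blockJoinLabel k m j) v w := by
  rcases v with v | v <;> rcases w with w | w <;>
    simp [BlockAdj, inl_mem_blockJoinCore, inr_notMem_blockJoinCore, blockJoin, join,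
      completeSimple, orderedBlocks, blockJoinLabel]

theorem blockOrder_blockJoin (j i : Fin l) :
    blockOrder (blockJoinCore k m) (blockJoinLabel k m j) i = m i := by
  have : univ.filter (fun v => v ∉ blockJoinCore k m ∧ blockJoinLabel k m j v = i) =
      (univ : Finset (Fin (m i))).map
        ((Function.Embedding.sigmaMk i).trans Function.Embedding.inr) := by
    ext v
    rcases v with v | ⟨a, v⟩
    · simp [inl_mem_blockJoinCore]
    · simp only [mem_map, mem_univ, true_and, Function.Embedding.trans_apply,
        Function.Embedding.sigmaMk_apply, Function.Embedding.inr_apply, Sum.inr.injEq]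
      rw [mem_filter]
      constructor
      · rintro ⟨-, -, rfl⟩
        exact ⟨v, rfl⟩
      · rintro ⟨u, hu⟩
        exact ⟨mem_univ _, inr_notMem_blockJoinCore _, (congrArg Sigma.fst hu).symm⟩
  rw [blockOrder, this, card_map, card_univ, Fintype.card_fin]

theorem blockJoin_isSimple : (blockJoin k m).IsSimple := by
  rintro (v | v) <;> simp [blockJoin, join, completeSimple, orderedBlocks]

theorem blockJoin_adj_inl_left (c : Fin k) {v : Fin k ⊕ (Σ i : Fin l, Fin (m i))}
    (h : v ≠ Sum.inl c) : (blockJoin k m).Adj (Sum.inl c) v := by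
  rcases v with v | v
  · exact fun h' => h (by rw [h'])
  · trivial

theorem blockJoin_adj_inl_right (c : Fin k) {v : Fin k ⊕ (Σ i : Fin l, Fin (m i))}
    (h : v ≠ Sum.inl c) : (blockJoin k m).Adj v (Sum.inl c) := by
  rcases v with v | v
  · exact fun h' => h (by rw [h'])
  · trivial

theorem deleteVerts_blockJoin_isStronglyConnected {c : Fin k}
    {S : Finset (Fin k ⊕ (Σ i : Fin l, Fin (m i)))} (hc : Sum.inl c ∉ S) :
    ((blockJoin k m).deleteVerts S).IsStronglyConnected := by
  have hto : ∀ x, ((blockJoin k m).deleteVerts S).Reaches x ⟨Sum.inl c, hc⟩ := fun x => by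
    by_cases h : x.1 = Sum.inl c
    · rw [show x = ⟨Sum.inl c, hc⟩ from Subtype.ext h]
      exact Relation.ReflTransGen.refl
    · exact Relation.ReflTransGen.single (blockJoin_adj_inl_right c h)
  have hfrom : ∀ x, ((blockJoin k m).deleteVerts S).Reaches ⟨Sum.inl c, hc⟩ x := fun x => by
    by_cases h : x.1 = Sum.inl c
    · rw [show x = ⟨Sum.inl c, hc⟩ from Subtype.ext h]
      exact Relation.ReflTransGen.refl
    · exact Relation.ReflTransGen.single (blockJoin_adj_inl_left c h)
  exact fun x y => ⟨(hto x).trans (hfrom y), (hto y).trans (hfrom x)⟩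

theorem blockJoin_isStronglyConnected (hk : 1 ≤ k) : (blockJoin k m).IsStronglyConnected := by
  have hto : ∀ x, (blockJoin k m).Reaches x (Sum.inl ⟨0, hk⟩) := fun x => by
    by_cases h : x = Sum.inl ⟨0, hk⟩
    · rw [h]
      exact Relation.ReflTransGen.refl
    · exact Relation.ReflTransGen.single (blockJoin_adj_inl_right _ h)
  have hfrom : ∀ x, (blockJoin k m).Reaches (Sum.inl ⟨0, hk⟩) x := fun x => by
    by_cases h : x = Sum.inl ⟨0, hk⟩
    · rw [h]
      exact Relation.ReflTransGen.refl
    · exact Relation.ReflTransGen.single (blockJoin_adj_inl_left _ h)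
  exact fun x y => ⟨(hto x).trans (hfrom y), (hto y).trans (hfrom x)⟩

theorem IsStronglyConnected.numStrongComponents_le_one {V : Type*} {D : Digraph V}
    (h : D.IsStronglyConnected) : D.numStrongComponents ≤ 1 := by
  have : Subsingleton (Quotient D.strongSetoid) :=
    ⟨fun a b => Quotient.inductionOn₂ a b fun x y => Quotient.sound (h x y)⟩
  exact Finite.card_le_one_iff_subsingleton.2 this

/-- Outside the core, labels never decrease along a path, so representatives of distinct blocks are
not mutually reachable. -/
theorem le_numStrongComponents_deleteVerts_core (j : Fin l) (hm : ∀ i, 1 ≤ m i) :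
    l ≤ ((blockJoin k m).deleteVerts (blockJoinCore k m)).numStrongComponents := by
  set D := (blockJoin k m).deleteVerts (blockJoinCore k m)
  have hmono : ∀ x y, D.Reaches x y → blockJoinLabel k m j x.1 ≤ blockJoinLabel k m j y.1 := by
    intro x y h
    induction h with
    | refl => exact le_rfl
    | tail _ hadj ih =>
      rename_i a b _
      exact ih.trans ((((blockJoin_adj_iff j a.1 b.1).1 hadj).2.resolve_left a.2).resolve_left b.2)
  let f : Fin l → Quotient D.strongSetoid := fun i =>
    Quotient.mk _ ⟨Sum.inr ⟨i, ⟨0, hm i⟩⟩, inr_notMem_blockJoinCore _⟩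
  have hf : Function.Injective f := fun i i' h =>
    have h' := Quotient.exact h
    le_antisymm (hmono _ _ h'.1) (hmono _ _ h'.2)
  simpa [numStrongComponents] using Nat.card_le_card_of_injective f hf

/-- Removing fewer than `k` vertices spares a core vertex, which is joined both ways to every other
survivor: one component remains, with more than `∑ i, m i ≥ l` vertices. -/
theorem blockJoin_lConnectivity (hl : 2 ≤ l) (hm : ∀ i, 1 ≤ m i) :
    (blockJoin k m).lConnectivity l = k := by
  have hsum : l ≤ ∑ i, m i := by
    simpa using card_nsmul_le_sum univ m 1 (fun i _ => hm i)
  refine le_antisymm (Nat.sInf_le ⟨blockJoinCore k m, card_blockJoinCore,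
    Or.inl (le_numStrongComponents_deleteVerts_core ⟨0, by omega⟩ hm)⟩) ?_
  obtain ⟨S, hS, h⟩ := (blockJoin k m).exists_separator (l := l) (by omega)
  rw [← hS]
  by_contra! hlt
  have : ∃ c : Fin k, Sum.inl c ∉ S := by
    by_contra! hall
    have : blockJoinCore k m ⊆ S := fun v hv => by
      obtain ⟨a, -, rfl⟩ := mem_map.1 hv
      exact hall a
    have := card_le_card this
    rw [card_blockJoinCore] at this
    omega
  obtain ⟨c, hc⟩ := this
  have h1 := (deleteVerts_blockJoin_isStronglyConnected hc).numStrongComponents_le_one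
  rw [natCard_notMem] at h
  simp only [Fintype.card_sum, Fintype.card_fin, Fintype.card_sigma] at h
  omega

theorem blockJoin_isInClass (hk : 1 ≤ k) (hl : 2 ≤ l) (hm : ∀ i, 1 ≤ m i) :
    (blockJoin k m).IsInClass (k + ∑ i, m i) k l where
  simple := blockJoin_isSimple
  order := by simp
  stronglyConnected := blockJoin_isStronglyConnected hk
  connectivity := blockJoin_lConnectivity hl hm

end BlockJoin

/-! ### The extremal orders and the comparison -/

theorem sum_extremalOrders {n k l : ℕ} (hn : k + l ≤ n) (j : Fin l) :
    k + ∑ i, extremalOrders n k l j i = n := by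
  have hl := j.pos
  unfold extremalOrders
  rw [← add_sum_erase univ _ (mem_univ j),
    sum_congr rfl (g := fun _ => 1) (fun i hi => if_neg (ne_of_mem_erase hi))]
  simp
  omega

theorem one_le_extremalOrders (n k l : ℕ) (j i : Fin l) : 1 ≤ extremalOrders n k l j i := by
  unfold extremalOrders
  split_ifs <;> omega

end Digraph

open Digraph in
theorem theorem1p2 (l n k : ℕ) (hl : 2 ≤ l) (hk : 1 ≤ k) (hn : k + l ≤ n) (j : Fin l) :
    (Digraph.extremal n k l j).IsInClass n k l ∧
      ∀ (V : Type*) [Fintype V] [DecidableEq V] (D : Digraph V), D.IsInClass n k l →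
        D.specRadius ≤ (Digraph.extremal n k l j).specRadius := by
  have hm := one_le_extremalOrders n k l j
  refine ⟨?_, fun V _ _ D hD => ?_⟩
  · have := blockJoin_isInClass hk hl hm
    rwa [sum_extremalOrders hn j] at this
  have hmj : extremalOrders n k l j j = n - k - l + 1 := if_pos rfl
  have hmax : ∀ i, extremalOrders n k l j i ≤ extremalOrders n k l j j := fun i => by
    rw [hmj, extremalOrders]
    split_ifs <;> omega
  obtain ⟨t, ht, hprod⟩ := exists_prod_one_sub_eq hk j (hm j)
  obtain ⟨S, b, hS, hb, hadj⟩ := hD.exists_blocks (by omega) hn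
  have hsum := sum_blockOrder S b
  rw [hD.order, hS] at hsum
  have ht1 : 1 < t := lt_of_le_of_lt (by exact_mod_cast hm j) ht
  -- The other `l - 1` blocks are nonempty, so no block of `D` exceeds `n - k - l + 1`.
  have hbt : ∀ i, (blockOrder S b i : ℝ) < t := fun i => by
    refine lt_of_le_of_lt (Nat.cast_le.2 ?_) ht
    have h1 := Finset.add_sum_erase Finset.univ (blockOrder S b) (Finset.mem_univ i)
    have h2 := Finset.card_nsmul_le_sum (Finset.univ.erase i) (blockOrder S b) 1 fun a _ => hb a
    change _ ≤ ∑ a ∈ Finset.univ.erase i, blockOrder S b a at h2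
    simp only [Finset.card_erase_of_mem (Finset.mem_univ i), Finset.card_univ, Fintype.card_fin,
      smul_eq_mul, mul_one] at h2
    omega
  have hle := prod_one_sub_extremal_le hb j (M := n - k - l + 1) (by omega) (hmj ▸ ht) ht1
  refine (specRadius_le_of_blockAdj hadj (hS ▸ hk) hbt (t := t) ?_).trans
    (le_specRadius_of_blockAdj_iff (blockJoin_adj_iff j) (t := t) ?_ ?_ ?_)
  · rw [hS, ← hprod]
    exact hle
  · rwa [card_blockJoinCore]
  · intro i
    rw [blockOrder_blockJoin]
    exact lt_of_le_of_lt (Nat.cast_le.2 (hmax i)) ht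
  · simpa only [blockOrder_blockJoin, card_blockJoinCore] using hprod
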